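/- Let $n,n_1,\dots,n_p\in\mathbb N$, let $S\subset\mathbb R^n$ be closed, and let $\mathbb R^n$ carry the Euclidean norm, with closed unit ball $\mathbb B$. For $i\in I=\{1,\dots,m\}$ let $f_i^L,f_i^U:\mathbb R^n\to\mathbb R$ be locally Lipschitz with $f_i^L\le f_i^U$ on $S$, and put $f_i(x)=[f_i^L(x),f_i^U(x)]$ and $\varphi=\sum_{i\in I}(f_i^L+f_i^U)$. For $j\in J=\{1,\dots,p\}$ let $\mathcal V_j\subset\mathbb R^{n_j}$ be nonempty and compact, let $g_j:\mathbb R^n\times\mathbb R^{n_j}\to\mathbb R$, and put $$g_j(x)=\max_{v\in\mathcal V_j}g_j(x,v),\qquad \mathcal V_j(x)=\{v\in\mathcal V_j: g_j(x,v)=g_j(x)\}.$$ The limiting normal cone $N(x;A)$ to a set $A$ at $x$ is the set of all $x^*$ for which there are $x^k\to x$ with $x^k\in A$, $\varepsilon_k\to0^+$ and $x_k^*\to x^*$ such that $\limsup_{u\to x^k,\,u\in A}\langle x_k^*,u-x^k\rangle/\|u-x^k\|\le\varepsilon_k$ for all $k$. The limiting subdifferential of $\psi:\mathbb R^n\to\mathbb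 R$ is $\partial\psi(x)=\{x^*:(x^*,-1)\in N((x,\psi(x));\operatorname{epi}\psi)\}$. The symbol $\partial_x$ denotes the limiting subdifferential with respect to $x$, and $\operatorname{co}$ the convex hull. Assume that for every $\bar x\in\mathbb R^n$ and every $j\in J$ there is $\delta>0$ such that: * $(\mathcal C_1)$ for each $x\in B(\bar x,\delta)$ the function $v\mapsto g_j(x,v)$ is upper semicontinuous on $\mathcal V_j$, and there is a constant $K$ with $|g_j(x_1,v)-g_j(x_2,v)|\le K\|x_1-x_2\|$ for all $x_1,x_2\in B(\bar x,\delta)$ and all $v\in\mathcal V_j$; * $(\mathcal C_2)$ for each $\bar v\in\mathcal V_j(\bar x)$ the multifunction $(x,v)\in B(\bar x,\delta)\times\mathcal V_j\rightrightarrows\partial_xg_j(x,v)$ is closed at $(\bar x,\bar v)$, i.e. if $(x^k,v^k)\to(\bar x,\bar v)$ in $B(\bar x,\delta)\times\mathcal V_j$ and $\xi^k\in\partial_xg_j(x^k,v^k)$ converge to $\xi$, then $\xi\in\partial_xg_j(\bar x,\bar v)$. Let the robust feasible set $\Omega=\{x\in S: g_j(x,v)\le0\ \ \forall v\in\mathcal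 V_j,\ \forall j\in J\}$ be nonempty. Let $\mathcal E_i=[\epsilon_i^L,\epsilon_i^U]$ with $0\le\epsilon_i^L\le\epsilon_i^U$ for $i\in I$, let $\theta=\sum_{i\in I}(\epsilon_i^L+\epsilon_i^U)>0$, and put $\Omega_{\mathcal E}=\{x\in S: g_j(x)\le\sqrt\theta\ \ \forall j\in J\}$. For intervals, $[a,b]-[c,d]=[a-d,b-c]$ and $k[a,b]=[ka,kb]$ for $k\ge0$; $[a,b]\le_{LU}[c,d]$ means $a\le c$ and $b\le d$, and $A<_{LU}B$ means $A\le_{LU}B$ and $A\ne B$. A point $z\in\Omega_{\mathcal E}$ is an almost $\mathcal E$-Pareto solution of the problem (RMP) of $LU$-minimizing $(f_1,\dots,f_m)$ over $\Omega$ if there is no $x\in\Omega$ with $f_i(x)\le_{LU}f_i(z)-\mathcal E_i$ for all $i\in I$ and $f_k(x)<_{LU}f_k(z)-\mathcal E_k$ for at least one $k\in I$. It is an almost $\mathcal E$-quasi Pareto solution if the same holds with $\frac{\|x-z\|}{\sqrt\theta}\mathcal E_i$ in place of $\mathcal E_i$ (and likewise for $k$), and it is almost regular $\mathcal E$-Pareto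 if it is both. **Theorem.** If $\varphi$ is bounded from below on $S$, then there exist an almost regular $\mathcal E$-Pareto solution $z$ of (RMP) and $\lambda\in\mathbb R^p_+$ such that $$0\in\sum_{i\in I}\bigl[\partial f_i^L(z)+\partial f_i^U(z)\bigr]+\sum_{j\in J}\lambda_j\operatorname{co}\Bigl(\bigcup_{v_j\in\mathcal V_j(z)}\partial_xg_j(z,v_j)\Bigr)+N(z;S)+\sqrt\theta\,\mathbb B,$$ $$\lambda_j>0\ \text{ for all } j\in J \text{ with } 0<g_j(z)\le\sqrt\theta,\qquad \lambda_j=0\ \text{ for all } j\in J \text{ with } g_j(z)\le0.$$ -/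

import Mathlib

open Filter Topology
open scoped Pointwise

noncomputable section

/-! ### Limiting normals and limiting subgradients -/

namespace Limiting

variable {E : Type*} [NormedAddCommGroup E] [InnerProductSpace ℝ E]

/-- The set `N̂_ε(x; S)` of `ε`-normals to `S` at `x`:
all `y` with `limsup_{u → x, u ∈ S, u ≠ x} ⟪y, u - x⟫ / ‖u - x‖ ≤ ε`.
The upper limit is taken in the extended reals, so it is `-∞` at an isolated point of `S`. -/
def epsNormals (ε : ℝ) (x : E) (S : Set E) : Set E :=
  {y | limsup (fun u => ((inner ℝ y (u - x) / ‖u - x‖ : ℝ) : EReal)) (𝓝[S \ {x}] x) ≤ (ε : EReal)}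

/-- The upper limit in the definition of `ε`-normals, written out. -/
theorem mem_epsNormals_iff (ε : ℝ) (x : E) (S : Set E) (y : E) :
    y ∈ epsNormals ε x S ↔
      ∀ η > 0, ∀ᶠ u in 𝓝[S] x, inner ℝ y (u - x) ≤ (ε + η) * ‖u - x‖ := by
  constructor
  · intro h η hη
    have h1 : limsup (fun u => ((inner ℝ y (u - x) / ‖u - x‖ : ℝ) : EReal)) (𝓝[S \ {x}] x)
        < ((ε + η : ℝ) : EReal) :=
      lt_of_le_of_lt h (by exact_mod_cast (by linarith : ε < ε + η))
    have h2 := eventually_lt_of_limsup_lt h1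
    rw [eventually_nhdsWithin_iff] at h2 ⊢
    filter_upwards [h2] with u hu huS
    by_cases hux : u = x
    · simp [hux]
    · have h3 := hu ⟨huS, hux⟩
      have h4 : 0 < ‖u - x‖ := norm_pos_iff.2 (sub_ne_zero.2 hux)
      have h5 : inner ℝ y (u - x) / ‖u - x‖ < ε + η := by exact_mod_cast h3
      exact ((div_lt_iff₀ h4).1 h5).le
  · intro h
    refine EReal.le_of_forall_lt_iff_le.1 ?_
    intro c hc
    have hc' : ε < c := by exact_mod_cast hc
    refine limsup_le_of_le (by isBoundedDefault) ?_
    have h1 := h (c - ε) (by linarith)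
    rw [eventually_nhdsWithin_iff] at h1 ⊢
    filter_upwards [h1] with u hu huS
    have h4 : 0 < ‖u - x‖ := norm_pos_iff.2 (sub_ne_zero.2 huS.2)
    have h5 : inner ℝ y (u - x) / ‖u - x‖ ≤ c := by
      rw [div_le_iff₀ h4]
      simpa using hu huS.1
    exact_mod_cast h5

/-- The limiting (Mordukhovich) normal cone `N(x; S)`: limits of `ε_k`-normals to `S` at points
`x_k ∈ S`, where `x_k → x` and `ε_k → 0⁺`. -/
def normalCone (x : E) (S : Set E) : Set E :=
  {y | ∃ (xs : ℕ → E) (εs : ℕ → ℝ) (ys : ℕ → E),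
    (∀ k, xs k ∈ S) ∧ Tendsto xs atTop (𝓝 x) ∧
    (∀ k, 0 < εs k) ∧ Tendsto εs atTop (𝓝 0) ∧
    (∀ k, ys k ∈ epsNormals (εs k) (xs k) S) ∧ Tendsto ys atTop (𝓝 y)}

/-- The epigraph of a real-valued function, in the product `E × ℝ` with its Euclidean structure. -/
def epigraph (φ : E → ℝ) : Set (WithLp 2 (E × ℝ)) :=
  {q | φ q.fst ≤ q.snd}

/-- The limiting (Mordukhovich) subdifferential of a real-valued function:
`∂φ(x) = {y | (y, -1) ∈ N((x, φ(x)); epi φ)}`. -/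
def subdiff (φ : E → ℝ) (x : E) : Set E :=
  {y | WithLp.toLp 2 (y, (-1 : ℝ)) ∈ normalCone (WithLp.toLp 2 (x, φ x)) (epigraph φ)}

end Limiting

/-! ### Intervals -/

/-- A compact interval `[lo, hi]`, recorded by its endpoints (`lo ≤ hi` for a genuine interval). -/
@[ext] structure Ivl where
  lo : ℝ
  hi : ℝ

namespace Ivl

/-- `[a, b] - [c, d] = [a - d, b - c]`. -/
def sub (A B : Ivl) : Ivl := ⟨A.lo - B.hi, A.hi - B.lo⟩

/-- `k [a, b]`, which is `[k a, k b]` for `k ≥ 0` and `[k b, k a]` for `k < 0`. -/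
def smul (k : ℝ) (A : Ivl) : Ivl :=
  if 0 ≤ k then ⟨k * A.lo, k * A.hi⟩ else ⟨k * A.hi, k * A.lo⟩

/-- `A ≤_LU B`. -/
def LeLU (A B : Ivl) : Prop := A.lo ≤ B.lo ∧ A.hi ≤ B.hi

/-- `A <_LU B`. -/
def LtLU (A B : Ivl) : Prop := LeLU A B ∧ A ≠ B

end Ivl

/-! ### The robust multiobjective problem -/

/-- The data of an uncertain multiobjective problem on `ℝⁿ` with `m` interval-valued objectives
`f_i = [f_i^L, f_i^U]`, `p` uncertain constraints `g_j(x, v_j) ≤ 0`, `v_j ∈ V_j ⊆ ℝ^{q_j}`, and a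
constraint set `S`. -/
structure RobustProblem (n m p : ℕ) where
  S : Set (EuclideanSpace ℝ (Fin n))
  fL : Fin m → EuclideanSpace ℝ (Fin n) → ℝ
  fU : Fin m → EuclideanSpace ℝ (Fin n) → ℝ
  q : Fin p → ℕ
  V : (j : Fin p) → Set (EuclideanSpace ℝ (Fin (q j)))
  g : (j : Fin p) → EuclideanSpace ℝ (Fin n) → EuclideanSpace ℝ (Fin (q j)) → ℝ

namespace RobustProblem

variable {n m p : ℕ} (P : RobustProblem n m p)

/-- The interval-valued objective `f_i(x) = [f_i^L(x), f_i^U(x)]`. -/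
def f (i : Fin m) (x : EuclideanSpace ℝ (Fin n)) : Ivl := ⟨P.fL i x, P.fU i x⟩

/-- The scalar objective `φ(x) = ∑ i, (f_i^L(x) + f_i^U(x))`. -/
def phi (x : EuclideanSpace ℝ (Fin n)) : ℝ := ∑ i, (P.fL i x + P.fU i x)

/-- The worst-case constraint function `g_j(x) = max_{v ∈ V_j} g_j(x, v)`. -/
def gmax (j : Fin p) (x : EuclideanSpace ℝ (Fin n)) : ℝ := sSup (P.g j x '' P.V j)

/-- The active uncertain parameters `V_j(x) = {v ∈ V_j | g_j(x, v) = g_j(x)}`. -/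
def active (j : Fin p) (x : EuclideanSpace ℝ (Fin n)) : Set (EuclideanSpace ℝ (Fin (P.q j))) :=
  {v | v ∈ P.V j ∧ P.g j x v = P.gmax j x}

/-- The partial limiting subdifferential `∂_x g_j(x, v)`. -/
def subdiffG (j : Fin p) (x : EuclideanSpace ℝ (Fin n)) (v : EuclideanSpace ℝ (Fin (P.q j))) :
    Set (EuclideanSpace ℝ (Fin n)) :=
  Limiting.subdiff (fun y => P.g j y v) x

/-- Condition (C₁) for `g_j` on the ball `B(x, δ)`: upper semicontinuity in the parameter on `V_j`,
and the Lipschitz property in the first variable with one rank for all parameters of `V_j`. -/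
def CondOne (j : Fin p) (x : EuclideanSpace ℝ (Fin n)) (δ : ℝ) : Prop :=
  (∀ y ∈ Metric.ball x δ, UpperSemicontinuousOn (P.g j y) (P.V j)) ∧
  ∃ K : ℝ, ∀ y₁ ∈ Metric.ball x δ, ∀ y₂ ∈ Metric.ball x δ, ∀ v ∈ P.V j,
    |P.g j y₁ v - P.g j y₂ v| ≤ K * ‖y₁ - y₂‖

/-- Condition (C₂) for `g_j` on the ball `B(x, δ)`: the multifunction
`(y, v) ∈ B(x, δ) × V_j ⇉ ∂_x g_j(y, v)` is closed at `(x, w)` for each active `w ∈ V_j(x)`. -/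
def CondTwo (j : Fin p) (x : EuclideanSpace ℝ (Fin n)) (δ : ℝ) : Prop :=
  ∀ w ∈ P.active j x,
    ∀ (ys : ℕ → EuclideanSpace ℝ (Fin n)) (vs : ℕ → EuclideanSpace ℝ (Fin (P.q j)))
      (ξs : ℕ → EuclideanSpace ℝ (Fin n)) (ξ : EuclideanSpace ℝ (Fin n)),
      (∀ k, ys k ∈ Metric.ball x δ) → (∀ k, vs k ∈ P.V j) →
      (∀ k, ξs k ∈ P.subdiffG j (ys k) (vs k)) →
      Tendsto ys atTop (𝓝 x) → Tendsto vs atTop (𝓝 w) → Tendsto ξs atTop (𝓝 ξ) →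
      ξ ∈ P.subdiffG j x w

/-- The robust feasible set `Ω`. -/
def feasible : Set (EuclideanSpace ℝ (Fin n)) :=
  {x | x ∈ P.S ∧ ∀ j, ∀ v ∈ P.V j, P.g j x v ≤ 0}

/-- `θ = ∑ i, (ε_i^L + ε_i^U)`, for the tolerances `𝓔_i = [ε_i^L, ε_i^U]`. -/
def theta (tol : Fin m → Ivl) : ℝ := ∑ i, ((tol i).lo + (tol i).hi)

/-- The `𝓔`-feasible set `Ω_𝓔`. -/
def epsFeasible (tol : Fin m → Ivl) : Set (EuclideanSpace ℝ (Fin n)) :=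
  {x | x ∈ P.S ∧ ∀ j, P.gmax j x ≤ √(theta tol)}

/-- `z` is an almost `𝓔`-Pareto solution. -/
def IsAlmostPareto (tol : Fin m → Ivl) (z : EuclideanSpace ℝ (Fin n)) : Prop :=
  z ∈ P.epsFeasible tol ∧
  ¬ ∃ x ∈ P.feasible,
    (∀ i, Ivl.LeLU (P.f i x) (Ivl.sub (P.f i z) (tol i))) ∧
    ∃ k, Ivl.LtLU (P.f k x) (Ivl.sub (P.f k z) (tol k))

/-- `z` is an almost `𝓔`-quasi Pareto solution. -/
def IsAlmostQuasiPareto (tol : Fin m → Ivl) (z : EuclideanSpace ℝ (Fin n)) : Prop :=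
  z ∈ P.epsFeasible tol ∧
  ¬ ∃ x ∈ P.feasible,
    (∀ i, Ivl.LeLU (P.f i x)
      (Ivl.sub (P.f i z) (Ivl.smul (‖x - z‖ / √(theta tol)) (tol i)))) ∧
    ∃ k, Ivl.LtLU (P.f k x)
      (Ivl.sub (P.f k z) (Ivl.smul (‖x - z‖ / √(theta tol)) (tol k)))

/-- `z` is an almost regular `𝓔`-Pareto solution. -/
def IsAlmostRegularPareto (tol : Fin m → Ivl) (z : EuclideanSpace ℝ (Fin n)) : Prop :=
  P.IsAlmostPareto tol z ∧ P.IsAlmostQuasiPareto tol z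

end RobustProblem

end

/-! The constraints are moved into the objective by the penalty `k * ∑ j, max (g_j) 0 ^ 2`, where
`k` is just large enough that every `θ`-minimizer over `S` violates each constraint by at most `√θ`.
Minimizing the penalized objective plus `√θ` times the distance to such a point gives `z`, which is
still a `θ`-minimizer and also minimizes the penalized objective plus `√θ * ‖x - z‖` over `S`
(`exists_approx_minimizer`). The penalty vanishes on `Ω`, so domination of `z` by a feasible point
would contradict one of these two properties.

At `z` the square has the second-order upper bound `max_zero_sq_le`. Up to a quadratic error, `z`
therefore minimizes `φ + ∑ λ_j g_j + √θ ‖· - z‖` over `S`, with `λ_j = 2 k max (g_j z) 0`; the sign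
conditions on `λ` are visible in this formula. The inclusion follows from a sum rule that tolerates
quadratic errors (`exists_isProxLimit_sum_add_normal_eq_zero`) and a supremum rule for the `g_j`
(`IsProxLimit.mem_convexHull_active`).

Both rules are proved for limits of proximal subgradients, which are limiting subgradients. The sum
rule decouples the variables by a quadratic penalty. The supremum rule separates a putative bad
subgradient from a compact convex hull and contradicts this by a mean value inequality. -/

/-- The convex hull of a compact set in a finite-dimensional space is compact. -/
theorem IsCompact.convexHull_of_finiteDimensional {E : Type*} [NormedAddCommGroup E]
    [NormedSpace ℝ E] [FiniteDimensional ℝ E] {D : Set E} (hD : IsCompact D) :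
    IsCompact (convexHull ℝ D) := by
  rcases D.eq_empty_or_nonempty with rfl | ⟨d, hd⟩
  · simp
  -- Carathéodory: `N` points suffice, so the hull is the continuous image of simplex × `D ^ N`.
  -- Spare slots are filled below with weight `0` and the point `d`.
  set N := Module.finrank ℝ E + 1
  have hcont : Continuous fun q : (Fin N → ℝ) × (Fin N → E) => ∑ i, q.1 i • q.2 i := by fun_prop
  have hcompact := ((isCompact_stdSimplex ℝ (Fin N)).prod
    (isCompact_univ_pi fun _ : Fin N => hD)).image hcont
  convert hcompact using 1
  ext x
  constructor
  · intro hx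
    obtain ⟨ι, _, z, w, hz, hind, hw, hsum, rfl⟩ := eq_pos_convex_span_of_mem_convexHull hx
    have hcard : Fintype.card ι ≤ Fintype.card (Fin N) := by
      rw [Fintype.card_fin]
      exact hind.card_le_finrank_succ.trans (Nat.succ_le_succ (Submodule.finrank_le _))
    obtain ⟨e⟩ := Function.Embedding.nonempty_of_card_le hcard
    refine ⟨(Function.extend e w 0, Function.extend e z fun _ => d), ⟨⟨fun i => ?_, ?_⟩,
      fun i _ => ?_⟩, ?_⟩
    · by_cases hi : ∃ a, e a = i
      · obtain ⟨a, rfl⟩ := hi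
        simpa [e.injective.extend_apply] using (hw a).le
      · simp [Function.extend_apply' _ _ _ hi]
    · rw [← hsum]
      refine (Fintype.sum_of_injective e e.injective _ _ (fun i hi => ?_) fun i => ?_).symm
      · exact Function.extend_apply' _ _ _ hi
      · simp [e.injective.extend_apply]
    · by_cases hi : ∃ a, e a = i
      · obtain ⟨a, rfl⟩ := hi
        simpa [e.injective.extend_apply] using hz ⟨a, rfl⟩
      · simpa [Function.extend_apply' _ _ _ hi] using hd
    · refine (Fintype.sum_of_injective e e.injective _ _ (fun i hi => ?_) fun i => ?_).symm
      · simp [Function.extend_apply' _ _ _ hi]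
      · simp [e.injective.extend_apply]
  · rintro ⟨q, ⟨hq, hz⟩, rfl⟩
    exact (convex_convexHull ℝ D).sum_mem (fun i _ => hq.1 i) hq.2
      fun i _ => subset_convexHull ℝ D (hz i trivial)

/-! ### Proximal limits, the sum rule and the mean value inequality. -/

namespace Limiting

variable {E : Type*} [NormedAddCommGroup E] [InnerProductSpace ℝ E]

/-- `ξ` is a limit of proximal subgradients of `f` at points converging to `z`. -/
def IsProxLimit (f : E → ℝ) (z ξ : E) : Prop :=
  ∃ (xs ξs : ℕ → E), Tendsto xs atTop (𝓝 z) ∧ Tendsto ξs atTop (𝓝 ξ) ∧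
    ∀ k, ∃ C : ℝ, ∀ᶠ u in 𝓝 (xs k),
      f (xs k) + inner ℝ (ξs k) (u - xs k) - C * ‖u - xs k‖ ^ 2 ≤ f u

/-- A quadratic estimate gives membership in the set of `ε`-normals. -/
theorem mem_epsNormals_of_quadratic {A : Set E} {x y : E} {ε C : ℝ} (hε : 0 < ε)
    (h : ∀ᶠ u in 𝓝[A] x, inner ℝ y (u - x) ≤ C * ‖u - x‖ ^ 2) : y ∈ epsNormals ε x A := by
  rw [mem_epsNormals_iff]
  intro η hη
  have ht : Tendsto (fun u => C * ‖u - x‖) (𝓝[A] x) (𝓝 0) := by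
    have : Continuous fun u => C * ‖u - x‖ := by fun_prop
    simpa using (this.tendsto x).mono_left nhdsWithin_le_nhds
  filter_upwards [h, ht.eventually_lt_const (add_pos hε hη)] with u hu hs
  have := mul_le_mul_of_nonneg_right hs.le (norm_nonneg (u - x))
  nlinarith

/-- A limit of proximal subgradients is a limiting subgradient. -/
theorem IsProxLimit.mem_subdiff {f : E → ℝ} {z ξ : E} (h : IsProxLimit f z ξ)
    (hf : ContinuousAt f z) : ξ ∈ subdiff f z := by
  obtain ⟨xs, ξs, hxs, hξs, hprox⟩ := h
  have hlim : ∀ {a : ℕ → E} {b : ℕ → ℝ} {x : E} {y : ℝ}, Tendsto a atTop (𝓝 x) →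
      Tendsto b atTop (𝓝 y) →
      Tendsto (fun k => WithLp.toLp 2 (a k, b k)) atTop (𝓝 (WithLp.toLp 2 (x, y))) := by
    intro a b x y ha hb
    exact ((WithLp.prod_continuous_toLp 2 E ℝ).tendsto _).comp (ha.prodMk_nhds hb)
  refine ⟨fun k => WithLp.toLp 2 (xs k, f (xs k)), fun k => 1 / ((k : ℝ) + 1),
    fun k => WithLp.toLp 2 (ξs k, (-1 : ℝ)), fun k => ?_, hlim hxs (hf.tendsto.comp hxs),
    fun k => by positivity, tendsto_one_div_add_atTop_nhds_zero_nat, fun k => ?_,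
    hlim hξs tendsto_const_nhds⟩
  · simp [epigraph]
  · obtain ⟨C, hC⟩ := hprox k
    -- The error is enlarged from the norm in `E` to the product norm, which needs a nonnegative
    -- coefficient.
    refine mem_epsNormals_of_quadratic (C := |C|) (by positivity) ?_
    rw [eventually_nhdsWithin_iff]
    have hfst : Tendsto (fun q : WithLp 2 (E × ℝ) => q.fst)
        (𝓝 (WithLp.toLp 2 (xs k, f (xs k)))) (𝓝 (xs k)) := by
      have : Continuous fun q : WithLp 2 (E × ℝ) => q.fst :=
        continuous_fst.comp (WithLp.prod_continuous_ofLp 2 E ℝ)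
      exact this.tendsto _
    filter_upwards [hfst.eventually hC] with q hq hqe
    have hqe' : f q.fst ≤ q.snd := hqe
    have hn : ‖q.fst - xs k‖ ^ 2 ≤ ‖q - WithLp.toLp 2 (xs k, f (xs k))‖ ^ 2 := by
      rw [WithLp.prod_norm_sq_eq_of_L2]
      exact le_add_of_nonneg_right (sq_nonneg _)
    rw [WithLp.prod_inner_apply]
    change inner ℝ (ξs k) (q.fst - xs k) + inner ℝ (-1 : ℝ) (q.snd - f (xs k)) ≤ _
    have h1 : C * ‖q.fst - xs k‖ ^ 2 ≤ |C| * ‖q - WithLp.toLp 2 (xs k, f (xs k))‖ ^ 2 :=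
      mul_le_mul (le_abs_self C) hn (by positivity) (abs_nonneg C)
    simp only [RCLike.inner_apply, map_neg, map_one]
    linarith

/-- Limits of proximal subgradients are bounded by a local Lipschitz constant. -/
theorem IsProxLimit.norm_le {f : E → ℝ} {z ξ : E} {K : ℝ} {U : Set E} (h : IsProxLimit f z ξ)
    (hK : 0 ≤ K) (hU : U ∈ 𝓝 z) (hf : ∀ x ∈ U, ∀ y ∈ U, f x - f y ≤ K * ‖x - y‖) : ‖ξ‖ ≤ K := by
  obtain ⟨xs, ξs, hxs, hξs, hprox⟩ := h
  refine le_of_tendsto hξs.norm ?_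
  filter_upwards [hxs.eventually (eventually_mem_nhds_iff.2 hU)] with k hk
  obtain ⟨C, hC⟩ := hprox k
  -- The proximal inequality is tested in the direction of the subgradient itself; dividing by `t`
  -- removes the quadratic term in the limit.
  have hx : Tendsto (fun t : ℝ => xs k + t • ξs k) (𝓝[>] 0) (𝓝 (xs k)) := by
    have : Continuous fun t : ℝ => xs k + t • ξs k := by fun_prop
    simpa using (this.tendsto 0).mono_left nhdsWithin_le_nhds
  have hlim : Tendsto (fun t : ℝ => ‖ξs k‖ ^ 2 - C * t * ‖ξs k‖ ^ 2) (𝓝[>] 0) (𝓝 (‖ξs k‖ ^ 2)) := by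
    have : Continuous fun t : ℝ => ‖ξs k‖ ^ 2 - C * t * ‖ξs k‖ ^ 2 := by fun_prop
    simpa using (this.tendsto 0).mono_left nhdsWithin_le_nhds
  have hsq : ‖ξs k‖ ^ 2 ≤ K * ‖ξs k‖ := by
    refine le_of_tendsto hlim ?_
    filter_upwards [hx.eventually hC, hx.eventually hk, self_mem_nhdsWithin] with t h1 h2 ht
    have ht' : (0 : ℝ) < t := ht
    have h3 := hf _ h2 _ (mem_of_mem_nhds hk)
    simp only [add_sub_cancel_left, inner_smul_right, real_inner_self_eq_norm_sq, norm_smul,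
      Real.norm_of_nonneg ht'.le] at h1 h3
    refine le_of_mul_le_mul_left ?_ ht'
    nlinarith
  rcases (norm_nonneg (ξs k)).eq_or_lt with h0 | h0
  · rw [← h0]; exact hK
  · refine le_of_mul_le_mul_right ?_ h0
    nlinarith

/-- A minimizer of the decoupled problem that replaces the sum of the functions `f i` over `S` by a
sum in separate variables with a quadratic penalty of weight `N`. -/
theorem exists_decoupled_minimizer [ProperSpace E] {ι : Type*} [Fintype ι] {f : ι → E → ℝ}
    {S : Set E} (hS : IsClosed S) {z : E} (hz : z ∈ S) {r K C N : ℝ} (hr : 0 < r)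
    (hN : 0 < N)
    (hf : ∀ i, ∀ x ∈ Metric.closedBall z r, ∀ y ∈ Metric.closedBall z r,
      |f i x - f i y| ≤ K * ‖x - y‖)
    (hmin : ∀ x ∈ S ∩ Metric.closedBall z r, ∑ i, f i z ≤ ∑ i, f i x + C * ‖x - z‖ ^ 2) :
    ∃ (a : E) (x : ι → E), a ∈ S ∧
      (∀ i, ∀ u ∈ Metric.closedBall z r,
        f i (x i) + inner ℝ ((2 * N) • (a - x i)) (u - x i) - N * ‖u - x i‖ ^ 2 ≤ f i u) ∧
      (∀ w ∈ S ∩ Metric.closedBall z r,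
        inner ℝ (-∑ i, (2 * N) • (a - x i) - (2 * (C + 1)) • (a - z)) (w - a) ≤
          (N * Fintype.card ι + (C + 1)) * ‖w - a‖ ^ 2) ∧
      ∑ i, N ^ 2 * ‖x i - a‖ ^ 2 + 2 * N * ‖a - z‖ ^ 2 ≤ Fintype.card ι * K ^ 2 := by
  classical
  set B := Metric.closedBall z r
  have hzB : z ∈ B := Metric.mem_closedBall_self hr.le
  have hfc : ∀ i, ContinuousOn (f i) B := fun i =>
    (LipschitzOnWith.of_dist_le_mul (K := K.toNNReal) fun x hx y hy => by
      rw [Real.dist_eq, dist_eq_norm]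
      exact (hf i x hx y hy).trans
        (mul_le_mul_of_nonneg_right (Real.le_coe_toNNReal K) (norm_nonneg _))).continuousOn
  -- Minimality in one `y_i` alone gives a proximal subgradient of `f i`, minimality in `w` alone a
  -- proximal normal to `S`. In `C + 1`, `C` absorbs the error in `hmin` and `1` keeps `a` close to
  -- `z`.
  let H : E × (ι → E) → ℝ := fun q =>
    ∑ i, (f i (q.2 i) + N * ‖q.2 i - q.1‖ ^ 2) + (C + 1) * ‖q.1 - z‖ ^ 2
  have hcompact : IsCompact ((S ∩ B) ×ˢ Set.pi Set.univ fun _ : ι => B) :=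
    ((isCompact_closedBall z r).inter_left hS).prod
      (isCompact_univ_pi fun _ => isCompact_closedBall z r)
  have hH : ContinuousOn H ((S ∩ B) ×ˢ Set.pi Set.univ fun _ : ι => B) := by
    refine ContinuousOn.add (continuousOn_finsetSum _ fun i _ => ContinuousOn.add ?_ ?_) ?_
    · exact (hfc i).comp (by fun_prop) fun q hq => hq.2 i trivial
    · exact Continuous.continuousOn (by fun_prop)
    · exact Continuous.continuousOn (by fun_prop)
  obtain ⟨⟨a, x⟩, ⟨ha, hx⟩, hax⟩ :=
    hcompact.exists_isMinOn ⟨(z, fun _ => z), ⟨hz, hzB⟩, fun _ _ => hzB⟩ hH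
  have hxB : ∀ i, x i ∈ B := fun i => hx i trivial
  have hle : ∀ w ∈ S ∩ B, ∀ y : ι → E, (∀ i, y i ∈ B) → H (a, x) ≤ H (w, y) := fun w hw y hy =>
    isMinOn_iff.1 hax (w, y) ⟨hw, fun i _ => hy i⟩
  refine ⟨a, x, ha.1, fun i u hu => ?_, fun w hw => ?_, ?_⟩
  · have h1 := hle a ha (Function.update x i u) fun j => by
      rcases eq_or_ne j i with rfl | hj
      · simpa using hu
      · simpa [hj] using hxB j
    simp only [H, add_le_add_iff_right] at h1
    rw [← Finset.add_sum_erase _ _ (Finset.mem_univ i),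
      ← Finset.add_sum_erase _ _ (Finset.mem_univ i)] at h1
    have h2 : ∑ j ∈ Finset.univ.erase i,
          (f j (Function.update x i u j) + N * ‖Function.update x i u j - a‖ ^ 2) =
        ∑ j ∈ Finset.univ.erase i, (f j (x j) + N * ‖x j - a‖ ^ 2) :=
      Finset.sum_congr rfl fun j hj => by rw [Function.update_of_ne (Finset.ne_of_mem_erase hj)]
    rw [h2, add_le_add_iff_right, Function.update_self] at h1
    have h3 : ‖u - a‖ ^ 2 =
        ‖u - x i‖ ^ 2 - 2 * inner ℝ (a - x i) (u - x i) + ‖x i - a‖ ^ 2 := by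
      rw [show u - a = (u - x i) - (a - x i) by abel, norm_sub_sq_real, norm_sub_rev a,
        real_inner_comm]
    rw [h3] at h1
    rw [inner_smul_left]
    simp only [conj_trivial]
    linarith
  · have h1 := hle w hw x hxB
    simp only [H, Finset.sum_add_distrib, add_assoc, add_le_add_iff_left] at h1
    have h2 : ∀ i, ‖x i - w‖ ^ 2 =
        ‖x i - a‖ ^ 2 + 2 * inner ℝ (a - x i) (w - a) + ‖w - a‖ ^ 2 := fun i => by
      rw [show x i - w = -((a - x i) + (w - a)) by abel, norm_neg, norm_add_sq_real,
        norm_sub_rev (x i) a]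
    have h3 : ‖w - z‖ ^ 2 = ‖a - z‖ ^ 2 + 2 * inner ℝ (a - z) (w - a) + ‖w - a‖ ^ 2 := by
      rw [show w - z = (a - z) + (w - a) by abel, norm_add_sq_real]
    simp only [h2, h3, mul_add, Finset.sum_add_distrib, Finset.sum_const, Finset.card_univ,
      nsmul_eq_mul] at h1
    rw [inner_sub_left, inner_neg_left, sum_inner]
    simp only [inner_smul_left, conj_trivial]
    simp only [mul_left_comm N 2, ← mul_assoc] at h1 ⊢
    nlinarith
  -- Comparison with the diagonal point `z`, followed by `2NK‖x i - a‖ ≤ N²‖x i - a‖² + K²`. The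
  -- resulting bound on `N * ‖x i - a‖` does not depend on `N`.
  · have h1 := hle z ⟨hz, hzB⟩ (fun _ => z) fun _ => hzB
    have h2 := hmin a ha
    simp only [H, sub_self, norm_zero, Finset.sum_add_distrib] at h1
    have h3 : ∑ i, f i a ≤ ∑ i, f i (x i) + ∑ i, K * ‖x i - a‖ := by
      rw [← Finset.sum_add_distrib]
      refine Finset.sum_le_sum fun i _ => ?_
      have := (abs_le.1 (hf i _ (hxB i) _ ha.2)).1
      linarith
    have h4 : ∑ i, 2 * N * (K * ‖x i - a‖) ≤ ∑ i, (N ^ 2 * ‖x i - a‖ ^ 2 + K ^ 2) :=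
      Finset.sum_le_sum fun i _ => by nlinarith [sq_nonneg (N * ‖x i - a‖ - K)]
    simp only [Finset.sum_add_distrib, Finset.sum_const, Finset.card_univ, nsmul_eq_mul,
      ← Finset.mul_sum] at h1 h3 h4 ⊢
    have h5 : N * ∑ i, ‖x i - a‖ ^ 2 + ‖a - z‖ ^ 2 ≤ K * ∑ i, ‖x i - a‖ := by
      simp at h1
      linarith
    have h6 := mul_le_mul_of_nonneg_left h5 (by positivity : 0 ≤ 2 * N)
    nlinarith

/-- The exact sum rule: if `z` minimizes a sum of Lipschitz functions over `S` near `z`, up to a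
quadratic error, then some limiting proximal subgradients and a limiting normal add up to zero. -/
theorem exists_isProxLimit_sum_add_normal_eq_zero [ProperSpace E] {ι : Type*} [Fintype ι]
    {f : ι → E → ℝ} {S : Set E} (hS : IsClosed S) {z : E} (hz : z ∈ S) {r K C : ℝ} (hr : 0 < r)
    (hf : ∀ i, ∀ x ∈ Metric.closedBall z r, ∀ y ∈ Metric.closedBall z r,
      |f i x - f i y| ≤ K * ‖x - y‖)
    (hmin : ∀ x ∈ S ∩ Metric.closedBall z r, ∑ i, f i z ≤ ∑ i, f i x + C * ‖x - z‖ ^ 2) :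
    ∃ (ξ : ι → E) (ν : E), (∀ i, IsProxLimit (f i) z (ξ i)) ∧ ν ∈ normalCone z S ∧
      ∑ i, ξ i + ν = 0 := by
  have hN : ∀ k : ℕ, (0 : ℝ) < k + 1 := fun k => by positivity
  choose a x haS hprox hnormal hest using fun k : ℕ =>
    exists_decoupled_minimizer hS hz hr (hN k) hf hmin
  set B : ℝ := Fintype.card ι * K ^ 2
  have hB : 0 ≤ B := by positivity
  have hinv : Tendsto (fun k : ℕ => B * (1 / ((k : ℝ) + 1))) atTop (𝓝 0) := by
    simpa using tendsto_one_div_add_atTop_nhds_zero_nat.const_mul B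
  have hdist : ∀ (k : ℕ) i, ((k : ℝ) + 1) ^ 2 * ‖x k i - a k‖ ^ 2 ≤ B := fun k i => by
    have h1 := hest k
    have h2 := Finset.single_le_sum (f := fun i => ((k : ℝ) + 1) ^ 2 * ‖x k i - a k‖ ^ 2)
      (fun j _ => by positivity) (Finset.mem_univ i)
    have h3 : 0 ≤ 2 * ((k : ℝ) + 1) * ‖a k - z‖ ^ 2 := by positivity
    linarith
  have htendsto : ∀ {u : ℕ → E}, (∀ k : ℕ, ((k : ℝ) + 1) * ‖u k‖ ^ 2 ≤ B) →
      Tendsto u atTop (𝓝 0) := fun {u} hu => by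
    rw [tendsto_zero_iff_norm_tendsto_zero]
    have : Tendsto (fun k => ‖u k‖ ^ 2) atTop (𝓝 0) := by
      refine squeeze_zero (fun k => by positivity) (fun k => ?_) hinv
      rw [mul_one_div, le_div_iff₀ (hN k)]
      linarith [hu k]
    simpa using this.sqrt
  have ha : Tendsto a atTop (𝓝 z) := by
    rw [← tendsto_sub_nhds_zero_iff]
    refine htendsto fun k => ?_
    have h1 := hest k
    have h2 : 0 ≤ ∑ i, ((k : ℝ) + 1) ^ 2 * ‖x k i - a k‖ ^ 2 :=
      Finset.sum_nonneg fun i _ => by positivity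
    have h3 : 0 ≤ ((k : ℝ) + 1) * ‖a k - z‖ ^ 2 := by positivity
    linarith
  have hx : ∀ i, Tendsto (fun k => x k i) atTop (𝓝 z) := fun i => by
    have h : Tendsto (fun k => x k i - a k) atTop (𝓝 0) := htendsto fun k => by
      refine le_trans (mul_le_mul_of_nonneg_right ?_ (by positivity)) (hdist k i)
      nlinarith [Nat.cast_nonneg (α := ℝ) k]
    simpa using h.add ha
  -- The subgradients `2N(a - x i)` stay bounded as the penalty weight grows, so a subsequence
  -- converges for all `i` at once.
  have hbound : ∀ k : ℕ, (fun i => (2 * ((k : ℝ) + 1)) • (a k - x k i)) ∈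
      Metric.closedBall (0 : ι → E) √(4 * B) := fun k => by
    rw [mem_closedBall_zero_iff, pi_norm_le_iff_of_nonneg (Real.sqrt_nonneg _)]
    intro i
    refine Real.le_sqrt_of_sq_le ?_
    rw [norm_smul, Real.norm_of_nonneg (by positivity), norm_sub_rev]
    nlinarith [hdist k i]
  obtain ⟨ξ, -, φ, hφ, hξ⟩ := tendsto_subseq_of_bounded Metric.isBounded_closedBall hbound
  have hev : ∀ᶠ k in atTop, Metric.closedBall z r ∈ 𝓝 (a (φ k)) ∧
      ∀ i, Metric.closedBall z r ∈ 𝓝 (x (φ k) i) := by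
    have hb : ∀ᶠ u in 𝓝 z, Metric.closedBall z r ∈ 𝓝 u :=
      eventually_mem_nhds_iff.2 (Metric.closedBall_mem_nhds z hr)
    exact ((ha.comp hφ.tendsto_atTop).eventually hb).and
      (eventually_all.2 fun i => ((hx i).comp hφ.tendsto_atTop).eventually hb)
  -- From `k₀` on, the minimizers are interior to the ball, so the localization imposes no
  -- constraint. The shift by `k₀` makes this hold for every index, as the definitions demand.
  obtain ⟨k₀, hk₀⟩ := eventually_atTop.1 hev
  have hψ : Tendsto (fun k => φ (k + k₀)) atTop atTop :=
    hφ.tendsto_atTop.comp (tendsto_add_atTop_nat k₀)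
  have hξψ := hξ.comp (tendsto_add_atTop_nat k₀)
  have hν : Tendsto (fun k => -∑ i, (2 * ((φ (k + k₀) : ℝ) + 1)) •
      (a (φ (k + k₀)) - x (φ (k + k₀)) i) - (2 * (C + 1)) • (a (φ (k + k₀)) - z)) atTop
      (𝓝 (-∑ i, ξ i)) := by
    have h1 := (tendsto_finsetSum Finset.univ fun i _ => tendsto_pi_nhds.1 hξψ i).neg
    have h2 := ((ha.comp hψ).sub_const z).const_smul (2 * (C + 1))
    simpa using h1.sub h2
  refine ⟨ξ, -∑ i, ξ i, fun i => ⟨fun k => x (φ (k + k₀)) i, _, (hx i).comp hψ,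
    tendsto_pi_nhds.1 hξψ i, fun k => ⟨(φ (k + k₀) : ℝ) + 1, ?_⟩⟩,
    ⟨fun k => a (φ (k + k₀)), fun k => 1 / ((k : ℝ) + 1), _, fun k => haS _, ha.comp hψ,
      fun k => by positivity, tendsto_one_div_add_atTop_nhds_zero_nat, fun k => ?_,
      hν⟩, by simp⟩
  · filter_upwards [(hk₀ _ (Nat.le_add_left k₀ k)).2 i] with u hu
    exact hprox _ i u hu
  · refine mem_epsNormals_of_quadratic
      (C := (φ (k + k₀) + 1) * Fintype.card ι + (C + 1)) (by positivity) ?_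
    rw [eventually_nhdsWithin_iff]
    filter_upwards [(hk₀ _ (Nat.le_add_left k₀ k)).1] with w hw hwS
    exact hnormal _ w ⟨hwS, hw⟩

/-- A limiting normal to a convex set has nonpositive inner product with feasible directions. -/
theorem inner_nonpos_of_mem_normalCone {A : Set E} (hA : Convex ℝ A) {c b ν : E} (hb : b ∈ A)
    (hν : ν ∈ normalCone c A) : inner ℝ ν (b - c) ≤ 0 := by
  obtain ⟨xs, εs, ys, hxA, hx, -, hε, hn, hy⟩ := hν
  have h1 : Tendsto (fun k => inner ℝ (ys k) (b - xs k)) atTop (𝓝 (inner ℝ ν (b - c))) :=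
    hy.inner (tendsto_const_nhds.sub hx)
  have h2 : Tendsto (fun k : ℕ => (εs k + 1 / ((k : ℝ) + 1)) * ‖b - xs k‖) atTop
      (𝓝 ((0 + 0) * ‖b - c‖)) :=
    (hε.add tendsto_one_div_add_atTop_nhds_zero_nat).mul (tendsto_const_nhds.sub hx).norm
  rw [add_zero, zero_mul] at h2
  refine le_of_tendsto_of_tendsto' h1 h2 fun k => ?_
  have h3 := (mem_epsNormals_iff _ _ _ _).1 (hn k) (1 / ((k : ℝ) + 1)) (by positivity)
  rw [eventually_nhdsWithin_iff] at h3
  have hl : Tendsto (fun t : ℝ => xs k + t • (b - xs k)) (𝓝[>] 0) (𝓝 (xs k)) := by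
    have : Continuous fun t : ℝ => xs k + t • (b - xs k) := by fun_prop
    simpa using (this.tendsto 0).mono_left nhdsWithin_le_nhds
  -- A single small `t` suffices: along the segment both sides of the `ε`-normal inequality are
  -- linear in `t`.
  obtain ⟨t, ht, h01⟩ := ((hl.eventually h3).and
    (Ioo_mem_nhdsGT (zero_lt_one' ℝ))).exists
  have h4 := ht (hA.add_smul_sub_mem (hxA k) hb ⟨h01.1.le, h01.2.le⟩)
  simp only [add_sub_cancel_left, inner_smul_right, norm_smul, Real.norm_of_nonneg h01.1.le] at h4
  refine le_of_mul_le_mul_left ?_ h01.1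
  linarith

/-- Subtracting a linear function shifts limits of proximal subgradients. -/
theorem IsProxLimit.add_inner {f : E → ℝ} {ℓ z ξ : E}
    (h : IsProxLimit (fun x => f x - inner ℝ ℓ x) z ξ) : IsProxLimit f z (ξ + ℓ) := by
  obtain ⟨xs, ξs, hxs, hξs, hprox⟩ := h
  refine ⟨xs, fun k => ξs k + ℓ, hxs, hξs.add_const ℓ, fun k => ?_⟩
  obtain ⟨C, hC⟩ := hprox k
  refine ⟨C, hC.mono fun u hu => ?_⟩
  rw [inner_add_left, inner_sub_right ℓ]
  linarith

/-- Positive multiples of limits of proximal subgradients. -/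
theorem IsProxLimit.of_const_mul {f : E → ℝ} {z ξ : E} {c : ℝ} (hc : 0 < c)
    (h : IsProxLimit (fun x => c * f x) z ξ) : IsProxLimit f z (c⁻¹ • ξ) := by
  obtain ⟨xs, ξs, hxs, hξs, hprox⟩ := h
  refine ⟨xs, fun k => c⁻¹ • ξs k, hxs, hξs.const_smul _, fun k => ?_⟩
  obtain ⟨C, hC⟩ := hprox k
  refine ⟨c⁻¹ * C, hC.mono fun u hu => ?_⟩
  rw [inner_smul_left]
  simp only [conj_trivial]
  refine le_of_mul_le_mul_left ?_ hc
  have : c * (f (xs k) + c⁻¹ * inner ℝ (ξs k) (u - xs k) - c⁻¹ * C * ‖u - xs k‖ ^ 2) =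
      c * f (xs k) + inner ℝ (ξs k) (u - xs k) - C * ‖u - xs k‖ ^ 2 := by
    field_simp
  linarith

/-- A mean value inequality for limiting proximal subgradients. -/
theorem exists_isProxLimit_sub_le_inner [ProperSpace E] {ψ : E → ℝ} {U : Set E} (hU : IsOpen U)
    {K : ℝ} (hψ : ∀ x ∈ U, ∀ y ∈ U, |ψ x - ψ y| ≤ K * ‖x - y‖) {a b : E}
    (hab : segment ℝ a b ⊆ U) :
    ∃ c ∈ segment ℝ a b, ∃ ζ, IsProxLimit ψ c ζ ∧ ψ b - ψ a ≤ inner ℝ ζ (b - a) := by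
  -- As in Rolle's argument, subtracting `ℓ` equalizes the values at the endpoints. For `a = b` the
  -- vector is `0`, so the degenerate segment is included.
  set ℓ : E := ((ψ b - ψ a) / ‖b - a‖ ^ 2) • (b - a)
  have hℓ : inner ℝ ℓ (b - a) = ψ b - ψ a := by
    rcases eq_or_ne a b with rfl | hne
    · simp
    · have : ‖b - a‖ ≠ 0 := norm_ne_zero_iff.2 (sub_ne_zero.2 hne.symm)
      simp only [ℓ, inner_smul_left, real_inner_self_eq_norm_sq, conj_trivial]
      field_simp
  set h : E → ℝ := fun x => ψ x - inner ℝ ℓ x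
  have hh : h b = h a := by
    simp only [h]
    rw [inner_sub_right] at hℓ
    linarith
  have hlip : ∀ x ∈ U, ∀ y ∈ U, |h x - h y| ≤ (K + ‖ℓ‖) * ‖x - y‖ := fun x hx y hy => by
    have h1 : h x - h y = (ψ x - ψ y) - inner ℝ ℓ (x - y) := by
      simp only [h, inner_sub_right]; ring
    rw [h1, add_mul]
    exact (abs_sub _ _).trans (add_le_add (hψ x hx y hy) (abs_real_inner_le_norm _ _))
  have hcont : ContinuousOn h (segment ℝ a b) :=
    (LipschitzOnWith.of_dist_le_mul (K := (K + ‖ℓ‖).toNNReal) fun x hx y hy => by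
      rw [Real.dist_eq, dist_eq_norm]
      exact (hlip x (hab hx) y (hab hy)).trans
        (mul_le_mul_of_nonneg_right (Real.le_coe_toNNReal _) (norm_nonneg _))).continuousOn
  have hcpt : IsCompact (segment ℝ a b) := by
    rw [segment_eq_image_lineMap]
    exact isCompact_Icc.image (by fun_prop)
  -- The minimizer must differ from `b`, so that the normal inequality in the direction `b - c = (1
  -- - t)(b - a)` can be divided by `1 - t > 0`. A minimum at `b` is also attained at `a`.
  have hmin : ∃ t ∈ Set.Ico (0 : ℝ) 1, ∀ x ∈ segment ℝ a b, h (a + t • (b - a)) ≤ h x := by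
    obtain ⟨c, hc, hcm⟩ := hcpt.exists_isMinOn ⟨a, left_mem_segment ℝ a b⟩ hcont
    rw [isMinOn_iff] at hcm
    rw [segment_eq_image'] at hc
    obtain ⟨t, ht, rfl⟩ := hc
    rcases ht.2.lt_or_eq with h1 | h1
    · exact ⟨t, ⟨ht.1, h1⟩, hcm⟩
    · refine ⟨0, ⟨le_rfl, one_pos⟩, fun x hx => ?_⟩
      have := hcm x hx
      simp only [h1, one_smul, add_sub_cancel] at this
      simpa [← hh] using this
  obtain ⟨t, ht, htm⟩ := hmin
  set c := a + t • (b - a)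
  have hc : c ∈ segment ℝ a b := by
    rw [segment_eq_image']
    exact ⟨t, ⟨ht.1, ht.2.le⟩, rfl⟩
  obtain ⟨r, hr, hball⟩ := Metric.nhds_basis_closedBall.mem_iff.1 (hU.mem_nhds (hab hc))
  obtain ⟨ξ, ν, hξ, hν, hsum⟩ := exists_isProxLimit_sum_add_normal_eq_zero
    (ι := Unit) (f := fun _ => h) hcpt.isClosed hc hr
    (fun _ x hx y hy => hlip x (hball hx) y (hball hy)) (C := 0)
    (fun x hx => by simpa using htm x hx.1)
  refine ⟨c, hc, ξ () + ℓ, (hξ ()).add_inner, ?_⟩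
  have h1 := inner_nonpos_of_mem_normalCone (convex_segment a b) (right_mem_segment ℝ a b) hν
  have h2 : b - c = (1 - t) • (b - a) := by simp only [c]; module
  rw [h2, inner_smul_right] at h1
  have h3 : inner ℝ ν (b - a) ≤ 0 := nonpos_of_mul_nonpos_right h1 (by linarith [ht.2])
  have h4 : ξ () = -ν := by simpa using eq_neg_of_add_eq_zero_left hsum
  rw [inner_add_left, hℓ, h4, inner_neg_left]
  linarith

end Limiting

/-! ### Suprema over a compact parameter set. -/

/-- On a nonempty compact set, an upper semicontinuous function attains its supremum, which is an
upper bound. -/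
theorem UpperSemicontinuousOn.exists_eq_sSup_image {F : Type*} [TopologicalSpace F] {V : Set F}
    {h : F → ℝ} (hh : UpperSemicontinuousOn h V) (hne : V.Nonempty) (hV : IsCompact V) :
    (∃ v ∈ V, h v = sSup (h '' V)) ∧ ∀ v ∈ V, h v ≤ sSup (h '' V) := by
  obtain ⟨v, hv, hmax⟩ := hh.exists_isMaxOn hne hV
  have hg : IsGreatest (h '' V) (h v) :=
    ⟨⟨v, hv, rfl⟩, by rintro _ ⟨w, hw, rfl⟩; exact isMaxOn_iff.1 hmax w hw⟩
  rw [hg.csSup_eq]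
  exact ⟨⟨v, hv, rfl⟩, fun w hw => hg.2 ⟨w, hw, rfl⟩⟩

/-- A supremum of equi-Lipschitz functions is Lipschitz. -/
theorem abs_sSup_image_sub_le {E F : Type*} [SeminormedAddCommGroup E] [TopologicalSpace F]
    {V : Set F} {g : E → F → ℝ} {U : Set E} {K : ℝ} (hne : V.Nonempty) (hV : IsCompact V)
    (husc : ∀ y ∈ U, UpperSemicontinuousOn (g y) V)
    (hlip : ∀ x ∈ U, ∀ y ∈ U, ∀ v ∈ V, |g x v - g y v| ≤ K * ‖x - y‖) :
    ∀ x ∈ U, ∀ y ∈ U, |sSup (g x '' V) - sSup (g y '' V)| ≤ K * ‖x - y‖ := by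
  have key : ∀ x ∈ U, ∀ y ∈ U, sSup (g x '' V) - sSup (g y '' V) ≤ K * ‖x - y‖ := by
    intro x hx y hy
    obtain ⟨v, hv, hvx⟩ := ((husc x hx).exists_eq_sSup_image hne hV).1
    have h1 := ((husc y hy).exists_eq_sSup_image hne hV).2 v hv
    have h2 := (abs_le.1 (hlip x hx y hy v hv)).2
    linarith
  intro x hx y hy
  rw [abs_le]
  have h1 := key y hy x hx
  rw [norm_sub_rev] at h1
  exact ⟨by linarith, key x hx y hy⟩

/-! ### Approximate minimizers and the supremum rule. -/

namespace Limiting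

/-- A function that is Lipschitz on a neighbourhood of a point is continuous there. -/
theorem continuousAt_of_abs_sub_le {E : Type*} [NormedAddCommGroup E] {f : E → ℝ}
    {z : E} {U : Set E} {K : ℝ} (hU : U ∈ 𝓝 z)
    (hf : ∀ x ∈ U, ∀ y ∈ U, |f x - f y| ≤ K * ‖x - y‖) : ContinuousAt f z :=
  (LipschitzOnWith.of_dist_le_mul (K := K.toNNReal) fun x hx y hy => by
    rw [Real.dist_eq, dist_eq_norm]
    exact (hf x hx y hy).trans (mul_le_mul_of_nonneg_right (Real.le_coe_toNNReal _)
      (norm_nonneg _))).continuousOn.continuousAt hU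

/-- An approximate minimizer that also minimizes a perturbation by a multiple of the distance. -/
theorem exists_approx_minimizer {E : Type*} [NormedAddCommGroup E] [ProperSpace E]
    {S : Set E} (hS : IsClosed S) (hne : S.Nonempty)
    {Φ : E → ℝ} (hΦ : ContinuousOn Φ S) (hbdd : BddBelow (Φ '' S)) {θ : ℝ} (hθ : 0 < θ) :
    ∃ z ∈ S, (∀ x ∈ S, Φ z ≤ Φ x + θ) ∧ ∀ x ∈ S, Φ z ≤ Φ x + √θ * ‖x - z‖ := by
  obtain ⟨_, ⟨x₀, hx₀, rfl⟩, hlt⟩ := exists_lt_of_csInf_lt (hne.image Φ)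
    (lt_add_of_pos_right (sInf (Φ '' S)) hθ)
  have hx₀' : ∀ x ∈ S, Φ x₀ ≤ Φ x + θ := fun x hx => by
    linarith [csInf_le hbdd ⟨x, hx, rfl⟩]
  have hmul : √θ * √θ = θ := Real.mul_self_sqrt hθ.le
  have hpos : 0 < √θ := Real.sqrt_pos.2 hθ
  obtain ⟨z, hz, hzmin⟩ := ((isCompact_closedBall x₀ √θ).inter_left hS).exists_isMinOn
    ⟨x₀, hx₀, Metric.mem_closedBall_self hpos.le⟩
    (f := fun x => Φ x + √θ * ‖x - x₀‖)
    ((hΦ.mono Set.inter_subset_left).add (Continuous.continuousOn (by fun_prop)))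
  rw [isMinOn_iff] at hzmin
  have hz₀ := hzmin x₀ ⟨hx₀, Metric.mem_closedBall_self hpos.le⟩
  simp only [sub_self, norm_zero, mul_zero, add_zero] at hz₀
  -- Outside the ball of radius `√θ` the distance term exceeds `θ`, more than `Φ` can gain over
  -- `x₀`; the minimum on the ball is thus global on `S`.
  have hglob : ∀ x ∈ S, Φ z + √θ * ‖z - x₀‖ ≤ Φ x + √θ * ‖x - x₀‖ := fun x hx => by
    by_cases hxb : x ∈ Metric.closedBall x₀ √θ
    · exact hzmin x ⟨hx, hxb⟩
    · rw [mem_closedBall_iff_norm, not_le] at hxb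
      nlinarith [hx₀' x hx]
  refine ⟨z, hz.1, fun x hx => ?_, fun x hx => ?_⟩
  · have : 0 ≤ √θ * ‖z - x₀‖ := by positivity
    linarith [hx₀' x hx]
  · have h1 : ‖x - x₀‖ ≤ ‖x - z‖ + ‖z - x₀‖ := by simpa using norm_add_le (x - z) (z - x₀)
    have h2 := mul_le_mul_of_nonneg_left h1 hpos.le
    linarith [hglob x hx]

variable {E : Type*} [NormedAddCommGroup E] [InnerProductSpace ℝ E]

/-- The sum rule, with neighbourhoods depending on the function. -/
theorem exists_isProxLimit_of_eventually [ProperSpace E] {ι : Type*} [Fintype ι]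
    {f : ι → E → ℝ} {S : Set E} (hS : IsClosed S) {z : E} (hz : z ∈ S) {C : ℝ}
    (hf : ∀ i, ∃ K : ℝ, 0 ≤ K ∧ ∃ U ∈ 𝓝 z, ∀ x ∈ U, ∀ y ∈ U, |f i x - f i y| ≤ K * ‖x - y‖)
    (hmin : ∀ᶠ x in 𝓝 z, x ∈ S → ∑ i, f i z ≤ ∑ i, f i x + C * ‖x - z‖ ^ 2) :
    ∃ (ξ : ι → E) (ν : E), (∀ i, IsProxLimit (f i) z (ξ i)) ∧ ν ∈ normalCone z S ∧
      ∑ i, ξ i + ν = 0 := by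
  choose K hK U hU hlip using hf
  obtain ⟨r, hr, hball⟩ := Metric.nhds_basis_closedBall.mem_iff.1
    (inter_mem (iInter_mem.2 hU) hmin)
  refine exists_isProxLimit_sum_add_normal_eq_zero hS hz hr (K := ∑ i, K i) (fun i x hx y hy => ?_)
    fun x hx => (hball hx.2).2 hx.1
  refine (hlip i x (Set.mem_iInter.1 (hball hx).1 i) y
    (Set.mem_iInter.1 (hball hy).1 i)).trans ?_
  exact mul_le_mul_of_nonneg_right
    (Finset.single_le_sum (fun j _ => hK j) (Finset.mem_univ i)) (norm_nonneg _)

section Supremum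

variable {F : Type*} [MetricSpace F] {V : Set F} {g : E → F → ℝ} {z : E} {δ K : ℝ}

/-- Bounded subgradients of the functions `g · v` at points near `z`, for parameters `v` active
near `z`, accumulate at subgradients for parameters active at `z`. -/
theorem exists_subseq_tendsto_subdiff_active [ProperSpace E] (hδ : 0 < δ)
    (hne : V.Nonempty) (hV : IsCompact V)
    (husc : ∀ y ∈ Metric.ball z δ, UpperSemicontinuousOn (g y) V)
    (hlip : ∀ x ∈ Metric.ball z δ, ∀ y ∈ Metric.ball z δ, ∀ v ∈ V,
      |g x v - g y v| ≤ K * ‖x - y‖)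
    (hclosed : ∀ w ∈ V, g z w = sSup (g z '' V) → ∀ (ys : ℕ → E) (vs : ℕ → F) (ξs : ℕ → E) (ξ : E),
      (∀ k, ys k ∈ Metric.ball z δ) → (∀ k, vs k ∈ V) →
      (∀ k, ξs k ∈ subdiff (fun y => g y (vs k)) (ys k)) →
      Tendsto ys atTop (𝓝 z) → Tendsto vs atTop (𝓝 w) → Tendsto ξs atTop (𝓝 ξ) →
      ξ ∈ subdiff (fun y => g y w) z)
    {us ys ζs : ℕ → E} {vs : ℕ → F} (hus : ∀ k, us k ∈ Metric.ball z δ)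
    (hys : ∀ k, ys k ∈ Metric.ball z δ) (hu : Tendsto us atTop (𝓝 z))
    (hy : Tendsto ys atTop (𝓝 z)) (hvs : ∀ k, vs k ∈ V)
    (hact : ∀ k, g (us k) (vs k) = sSup (g (us k) '' V))
    (hζ : ∀ k, ζs k ∈ subdiff (fun y => g y (vs k)) (ys k)) (hζK : ∀ k, ‖ζs k‖ ≤ K) :
    ∃ ζ, (∃ w ∈ V, g z w = sSup (g z '' V) ∧ ζ ∈ subdiff (fun y => g y w) z ∧ ‖ζ‖ ≤ K) ∧
      ∃ φ : ℕ → ℕ, StrictMono φ ∧ Tendsto (ζs ∘ φ) atTop (𝓝 ζ) := by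
  obtain ⟨⟨w, ζ⟩, ⟨hw, hζ'⟩, φ, hφ, hlim⟩ :=
    (hV.prod (isCompact_closedBall (0 : E) K)).tendsto_subseq (x := fun k => (vs k, ζs k))
      fun k => ⟨hvs k, by simpa using hζK k⟩
  have hwlim : Tendsto (vs ∘ φ) atTop (𝓝 w) := (continuous_fst.tendsto _).comp hlim
  have hζlim : Tendsto (ζs ∘ φ) atTop (𝓝 ζ) := (continuous_snd.tendsto _).comp hlim
  have hz : z ∈ Metric.ball z δ := Metric.mem_ball_self hδ
  have hsup := abs_sSup_image_sub_le hne hV husc hlip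
  -- Activity is known at `us`, while the subgradients live at `ys`. The uniform Lipschitz bound
  -- moves the values from `us` to `z`, where upper semicontinuity in the parameter applies.
  have hactive : g z w = sSup (g z '' V) := by
    refine le_antisymm (((husc z hz).exists_eq_sSup_image hne hV).2 w hw) ?_
    refine le_of_forall_gt_imp_ge_of_dense fun c hc => ?_
    have h1 : Tendsto (fun k => sSup (g (us (φ k)) '' V) - K * ‖us (φ k) - z‖) atTop
        (𝓝 (sSup (g z '' V) - K * ‖z - z‖)) :=
      ((continuousAt_of_abs_sub_le (Metric.ball_mem_nhds z hδ) hsup).tendsto.comp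
        (hu.comp hφ.tendsto_atTop)).sub
        (((hu.comp hφ.tendsto_atTop).sub_const z).norm.const_mul K)
    rw [sub_self, norm_zero, mul_zero, sub_zero] at h1
    refine le_of_tendsto h1 ?_
    have h2 : Tendsto (vs ∘ φ) atTop (𝓝[V] w) :=
      tendsto_nhdsWithin_iff.2 ⟨hwlim, Eventually.of_forall fun k => hvs _⟩
    filter_upwards [h2.eventually (husc z hz w hw c hc)] with k hk
    have h3 := (abs_le.1 (hlip _ (hus (φ k)) z hz _ (hvs (φ k)))).2
    rw [hact] at h3
    simp only [Function.comp_apply] at hk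
    linarith
  exact ⟨ζ, ⟨w, hw, hactive, hclosed w hw hactive (ys ∘ φ) (vs ∘ φ) (ζs ∘ φ) ζ (fun k => hys _)
    (fun k => hvs _) (fun k => hζ _) (hy.comp hφ.tendsto_atTop) hwlim hζlim, by simpa using hζ'⟩,
    φ, hφ, hζlim⟩

/-- The supremum rule: limiting proximal subgradients of `x ↦ sup_v g x v` lie in the convex hull
of the limiting subgradients of the functions `g · v` with `v` active. -/
theorem IsProxLimit.mem_convexHull_active [FiniteDimensional ℝ E] {ξ : E} (hδ : 0 < δ)
    (hK : 0 ≤ K) (hne : V.Nonempty) (hV : IsCompact V)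
    (husc : ∀ y ∈ Metric.ball z δ, UpperSemicontinuousOn (g y) V)
    (hlip : ∀ x ∈ Metric.ball z δ, ∀ y ∈ Metric.ball z δ, ∀ v ∈ V,
      |g x v - g y v| ≤ K * ‖x - y‖)
    (hclosed : ∀ w ∈ V, g z w = sSup (g z '' V) → ∀ (ys : ℕ → E) (vs : ℕ → F) (ξs : ℕ → E) (ξ : E),
      (∀ k, ys k ∈ Metric.ball z δ) → (∀ k, vs k ∈ V) →
      (∀ k, ξs k ∈ subdiff (fun y => g y (vs k)) (ys k)) →
      Tendsto ys atTop (𝓝 z) → Tendsto vs atTop (𝓝 w) → Tendsto ξs atTop (𝓝 ξ) →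
      ξ ∈ subdiff (fun y => g y w) z)
    (h : IsProxLimit (fun x => sSup (g x '' V)) z ξ) :
    ξ ∈ convexHull ℝ (⋃ w ∈ {v | v ∈ V ∧ g z v = sSup (g z '' V)}, subdiff (fun y => g y w) z) := by
  have : ProperSpace E := FiniteDimensional.proper ℝ E
  have hz : z ∈ Metric.ball z δ := Metric.mem_ball_self hδ
  -- The bound `‖ζ‖ ≤ K` is imposed to make `D` compact; the subgradients produced by the mean value
  -- inequality satisfy it.
  set D : Set E := {ζ | ∃ w ∈ V, g z w = sSup (g z '' V) ∧ ζ ∈ subdiff (fun y => g y w) z ∧ ‖ζ‖ ≤ K}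
  have hDsub : D ⊆ ⋃ w ∈ {v | v ∈ V ∧ g z v = sSup (g z '' V)}, subdiff (fun y => g y w) z := by
    rintro ζ ⟨w, hw, hwz, hζ, -⟩
    exact Set.mem_biUnion (x := w) ⟨hw, hwz⟩ hζ
  refine convexHull_mono hDsub ?_
  have hD : IsCompact D := by
    refine IsSeqCompact.isCompact fun ζs hζs => ?_
    choose vs hvs hact hζ hζK using hζs
    exact exists_subseq_tendsto_subdiff_active hδ hne hV husc hlip hclosed (fun _ => hz)
      (fun _ => hz) tendsto_const_nhds tendsto_const_nhds hvs hact hζ hζK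
  by_contra hξD
  obtain ⟨ℓ, s, hs, hsξ⟩ := geometric_hahn_banach_closed_point (convex_convexHull ℝ D)
    hD.convexHull_of_finiteDimensional.isClosed hξD
  set d := (InnerProductSpace.toDual ℝ E).symm ℓ
  have hd : ∀ x, inner ℝ x d = ℓ x := fun x => by
    rw [real_inner_comm, InnerProductSpace.toDual_symm_apply]
  obtain ⟨xs, ξs, hxs, hξs, hprox⟩ := h
  obtain ⟨k₀, hk₀⟩ := eventually_atTop.1 (hxs.eventually (Metric.ball_mem_nhds z hδ))
  -- Take a short step from `x` in the separating direction to `u`, and `v` active at `u`. As `g x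
  -- v` is at most the supremum at `x`, the function `g · v` grows at least as much as the supremum
  -- does. The mean value inequality turns this growth into a subgradient `ζ` of `g · v`.
  have hstep : ∀ k : ℕ, ∃ (u c ζ : E) (v : F), u ∈ Metric.ball z δ ∧ c ∈ Metric.ball z δ ∧
      ‖u - xs (k + k₀)‖ ≤ 1 / ((k : ℝ) + 1) ∧ ‖c - xs (k + k₀)‖ ≤ 1 / ((k : ℝ) + 1) ∧ v ∈ V ∧
      g u v = sSup (g u '' V) ∧ ζ ∈ subdiff (fun y => g y v) c ∧ ‖ζ‖ ≤ K ∧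
      inner ℝ (ξs (k + k₀)) d - 1 / ((k : ℝ) + 1) ≤ inner ℝ ζ d := by
    intro k
    set x := xs (k + k₀)
    have hx : x ∈ Metric.ball z δ := hk₀ _ (Nat.le_add_left k₀ k)
    have hη : (0 : ℝ) < 1 / ((k : ℝ) + 1) := by positivity
    obtain ⟨C, hC⟩ := hprox (k + k₀)
    have hl : Tendsto (fun t : ℝ => x + t • d) (𝓝[>] 0) (𝓝 x) := by
      have : Continuous fun t : ℝ => x + t • d := by fun_prop
      simpa using (this.tendsto 0).mono_left nhdsWithin_le_nhds
    have hq : Tendsto (fun t : ℝ => C * t * ‖d‖ ^ 2) (𝓝[>] 0) (𝓝 0) := by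
      have : Continuous fun t : ℝ => C * t * ‖d‖ ^ 2 := by fun_prop
      simpa using (this.tendsto 0).mono_left nhdsWithin_le_nhds
    obtain ⟨t, h1, h2, h3, h4, ht⟩ := ((hl.eventually hC).and ((hl.eventually
      (Metric.isOpen_ball.mem_nhds hx)).and ((hl.eventually (Metric.closedBall_mem_nhds x hη)).and
      ((hq.eventually_lt_const hη).and self_mem_nhdsWithin)))).exists
    have ht' : (0 : ℝ) < t := ht
    obtain ⟨v, hv, hvu⟩ := ((husc _ h2).exists_eq_sSup_image hne hV).1
    obtain ⟨c, hc, ζ, hζ, hmean⟩ := exists_isProxLimit_sub_le_inner Metric.isOpen_ball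
      (ψ := fun y => g y v) (fun x hx y hy => hlip x hx y hy v hv)
      ((convex_ball z δ).segment_subset hx h2)
    have hcB := (convex_ball z δ).segment_subset hx h2 hc
    have hcU : Metric.ball z δ ∈ 𝓝 c := Metric.isOpen_ball.mem_nhds hcB
    rw [dist_eq_norm] at h3
    refine ⟨_, c, ζ, v, h2, hcB, h3, ?_, hv, hvu,
      hζ.mem_subdiff (continuousAt_of_abs_sub_le hcU fun x hx y hy => hlip x hx y hy v hv),
      hζ.norm_le hK hcU fun x hx y hy => (le_abs_self _).trans (hlip x hx y hy v hv), ?_⟩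
    · exact mem_closedBall_iff_norm.1 ((convex_closedBall x _).segment_subset
        (Metric.mem_closedBall_self hη.le) (mem_closedBall_iff_norm.2 h3) hc)
    · have h5 := ((husc x hx).exists_eq_sSup_image hne hV).2 v hv
      simp only [x] at h1 h5 hmean hvu
      simp only [add_sub_cancel_left, inner_smul_right, norm_smul,
        Real.norm_of_nonneg ht'.le] at h1 hmean
      refine le_of_mul_le_mul_left ?_ ht'
      nlinarith
  choose us cs ζs vs hus hcs hux hcx hvs hact hζ hζK hineq using hstep
  have hxk : Tendsto (fun k => xs (k + k₀)) atTop (𝓝 z) := hxs.comp (tendsto_add_atTop_nat k₀)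
  have hnear : ∀ {y : ℕ → E}, (∀ k : ℕ, ‖y k - xs (k + k₀)‖ ≤ 1 / ((k : ℝ) + 1)) →
      Tendsto y atTop (𝓝 z) := fun {y} hy => by
    have := squeeze_zero_norm hy tendsto_one_div_add_atTop_nhds_zero_nat
    simpa using this.add hxk
  obtain ⟨ζ, hζD, φ, hφ, hlim⟩ := exists_subseq_tendsto_subdiff_active hδ hne hV husc hlip hclosed
    hus hcs (hnear hux) (hnear hcx) hvs hact hζ hζK
  have hle : inner ℝ ξ d ≤ inner ℝ ζ d := by
    have h1 : Tendsto (fun k : ℕ => inner ℝ (ξs (k + k₀)) d - 1 / ((k : ℝ) + 1)) atTop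
        (𝓝 (inner ℝ ξ d - 0)) :=
      ((hξs.comp (tendsto_add_atTop_nat k₀)).inner tendsto_const_nhds).sub
        tendsto_one_div_add_atTop_nhds_zero_nat
    rw [sub_zero] at h1
    exact le_of_tendsto_of_tendsto' (h1.comp hφ.tendsto_atTop) (hlim.inner tendsto_const_nhds)
      fun k => hineq (φ k)
  rw [hd, hd] at hle
  linarith [hs ζ (subset_convexHull ℝ D hζD)]

end Supremum

/-- A function that is Lipschitz near a point has a limiting proximal subgradient there. -/
theorem exists_isProxLimit [ProperSpace E] {f : E → ℝ} {z : E} {U : Set E} (hU : IsOpen U)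
    (hz : z ∈ U) {K : ℝ} (hf : ∀ x ∈ U, ∀ y ∈ U, |f x - f y| ≤ K * ‖x - y‖) :
    ∃ ζ, IsProxLimit f z ζ := by
  obtain ⟨c, hc, ζ, hζ, -⟩ := exists_isProxLimit_sub_le_inner hU hf (a := z) (b := z)
    (by simpa using hz)
  rw [segment_same, Set.mem_singleton_iff] at hc
  exact ⟨ζ, hc ▸ hζ⟩

end Limiting

/-! ### Constraint multipliers, the penalized objective and domination. -/

namespace RobustProblem

variable {n m p : ℕ} {P : RobustProblem n m p}

/-- A locally Lipschitz function, with the estimate written out. -/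
theorem _root_.LocallyLipschitz.exists_abs_sub_le {E : Type*} [SeminormedAddCommGroup E] {f : E → ℝ}
    (hf : LocallyLipschitz f) (z : E) :
    ∃ K : ℝ, 0 ≤ K ∧ ∃ U ∈ 𝓝 z, ∀ x ∈ U, ∀ y ∈ U, |f x - f y| ≤ K * ‖x - y‖ := by
  obtain ⟨K, U, hU, h⟩ := hf z
  exact ⟨K, K.2, U, hU, fun x hx y hy => by
    simpa [Real.dist_eq, dist_eq_norm] using h.dist_le_mul x hx y hy⟩

/-- The Lipschitz constant of `CondOne` may be taken nonnegative. -/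
theorem CondOne.exists_nonneg {j : Fin p} {z : EuclideanSpace ℝ (Fin n)} {δ : ℝ}
    (h : P.CondOne j z δ) :
    ∃ K : ℝ, 0 ≤ K ∧ ∀ x ∈ Metric.ball z δ, ∀ y ∈ Metric.ball z δ, ∀ v ∈ P.V j,
      |P.g j x v - P.g j y v| ≤ K * ‖x - y‖ := by
  obtain ⟨K, hK⟩ := h.2
  exact ⟨|K|, abs_nonneg K, fun x hx y hy v hv => (hK x hx y hy v hv).trans
    (mul_le_mul_of_nonneg_right (le_abs_self K) (norm_nonneg _))⟩

/-- The worst-case constraint functions are Lipschitz where `CondOne` holds. -/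
theorem CondOne.exists_abs_gmax_sub_le {j : Fin p} {z : EuclideanSpace ℝ (Fin n)} {δ : ℝ}
    (hδ : 0 < δ) (h : P.CondOne j z δ) (hne : (P.V j).Nonempty) (hV : IsCompact (P.V j)) :
    ∃ K : ℝ, 0 ≤ K ∧ ∃ U ∈ 𝓝 z, ∀ x ∈ U, ∀ y ∈ U, |P.gmax j x - P.gmax j y| ≤ K * ‖x - y‖ := by
  obtain ⟨K, hK0, hK⟩ := h.exists_nonneg
  exact ⟨K, hK0, _, Metric.ball_mem_nhds z hδ, abs_sSup_image_sub_le hne hV h.1 hK⟩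

/-- Limits of proximal subgradients of `λ • g_j` lie in `λ` times the convex hull of the
subgradients at the active parameters. -/
theorem mem_smul_convexHull {j : Fin p} {z ξ : EuclideanSpace ℝ (Fin n)} {δ c : ℝ}
    (hδ : 0 < δ) (h₁ : P.CondOne j z δ) (h₂ : P.CondTwo j z δ) (hne : (P.V j).Nonempty)
    (hV : IsCompact (P.V j)) (hc : 0 ≤ c)
    (hξ : Limiting.IsProxLimit (fun x => c * P.gmax j x) z ξ) :
    ξ ∈ c • convexHull ℝ (⋃ v ∈ P.active j z, P.subdiffG j z v) := by
  obtain ⟨K, hK0, hK⟩ := h₁.exists_nonneg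
  have hz : z ∈ Metric.ball z δ := Metric.mem_ball_self hδ
  rcases hc.eq_or_lt with rfl | hc
  -- For `c = 0` the set `0 • A` is `{0}` only when `A` is nonempty, so an active parameter with a
  -- subgradient has to be exhibited.
  · have h0 : ξ = 0 := norm_le_zero_iff.1 (hξ.norm_le le_rfl univ_mem (by simp))
    obtain ⟨v, hv, hvz⟩ := ((h₁.1 z hz).exists_eq_sSup_image hne hV).1
    obtain ⟨ζ, hζ⟩ := Limiting.exists_isProxLimit (f := fun y => P.g j y v) Metric.isOpen_ball hz
      fun x hx y hy => hK x hx y hy v hv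
    have hζ' : ζ ∈ P.subdiffG j z v := hζ.mem_subdiff
      (Limiting.continuousAt_of_abs_sub_le (Metric.ball_mem_nhds z hδ)
        fun x hx y hy => hK x hx y hy v hv)
    refine ⟨ζ, subset_convexHull ℝ _ (Set.mem_biUnion (x := v) ⟨hv, hvz⟩ hζ'), by simp [h0]⟩
  · refine ⟨c⁻¹ • ξ, ?_, smul_inv_smul₀ hc.ne' ξ⟩
    exact Limiting.IsProxLimit.mem_convexHull_active hδ hK0 hne hV h₁.1 hK
      (fun w hw hwz => h₂ w ⟨hw, hwz⟩) (hξ.of_const_mul hc)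

/-- The objective penalized by the squared violations of the constraints, with weight `k`. -/
noncomputable def penalized (P : RobustProblem n m p) (k : ℝ) (x : EuclideanSpace ℝ (Fin n)) : ℝ :=
  P.phi x + k * ∑ j, max (P.gmax j x) 0 ^ 2

theorem phi_le_penalized {k : ℝ} (hk : 0 ≤ k) (x : EuclideanSpace ℝ (Fin n)) :
    P.phi x ≤ P.penalized k x :=
  le_add_of_nonneg_right (mul_nonneg hk (Finset.sum_nonneg fun _ _ => sq_nonneg _))

theorem penalized_of_feasible {k : ℝ} {x : EuclideanSpace ℝ (Fin n)} (hx : x ∈ P.feasible) :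
    P.penalized k x = P.phi x := by
  have : ∀ j, max (P.gmax j x) 0 = 0 := fun j =>
    max_eq_right (Real.sSup_nonpos (by rintro _ ⟨v, hv, rfl⟩; exact hx.2 j v hv))
  simp [penalized, this]

/-- A point that improves every objective by a multiple of the tolerances, and one of them
strictly, decreases the scalar objective by more than that multiple of `θ`. -/
theorem phi_lt_of_dominates {tol : Fin m → Ivl} {x z : EuclideanSpace ℝ (Fin n)} {c : ℝ}
    {T : Fin m → Ivl} (hT : ∀ i, T i = ⟨c * (tol i).lo, c * (tol i).hi⟩)
    (hle : ∀ i, Ivl.LeLU (P.f i x) (Ivl.sub (P.f i z) (T i)))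
    (hlt : ∃ k, Ivl.LtLU (P.f k x) (Ivl.sub (P.f k z) (T k))) :
    P.phi x < P.phi z - c * theta tol := by
  have h : P.phi z - c * theta tol =
      ∑ i, ((P.fL i z - c * (tol i).hi) + (P.fU i z - c * (tol i).lo)) := by
    rw [phi, theta, Finset.mul_sum, ← Finset.sum_sub_distrib]
    exact Finset.sum_congr rfl fun i _ => by ring
  have hle' : ∀ i, P.fL i x ≤ P.fL i z - c * (tol i).hi ∧
      P.fU i x ≤ P.fU i z - c * (tol i).lo := fun i => by
    simpa [Ivl.LeLU, Ivl.sub, f, hT] using hle i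
  obtain ⟨k, -, hne⟩ := hlt
  rw [h, phi]
  -- If the endpoint sums agreed at index `k`, both endpoint inequalities would be equalities and
  -- the two intervals would coincide.
  refine Finset.sum_lt_sum (fun i _ => add_le_add (hle' i).1 (hle' i).2)
    ⟨k, Finset.mem_univ k, lt_of_le_of_ne (add_le_add (hle' k).1 (hle' k).2) fun heq => hne ?_⟩
  have := hle' k
  ext <;> simp only [Ivl.sub, f, hT] <;> linarith

/-- An approximate minimizer of the penalized objective is an almost regular solution. -/
theorem isAlmostRegularPareto_of_penalized {tol : Fin m → Ivl} {z : EuclideanSpace ℝ (Fin n)}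
    {k : ℝ} (hk : 0 ≤ k) (htheta : 0 < theta tol) (hz : z ∈ P.epsFeasible tol)
    (h₁ : ∀ x ∈ P.S, P.penalized k z ≤ P.penalized k x + theta tol)
    (h₂ : ∀ x ∈ P.S, P.penalized k z ≤ P.penalized k x + √(theta tol) * ‖x - z‖) :
    P.IsAlmostRegularPareto tol z := by
  refine ⟨⟨hz, ?_⟩, hz, ?_⟩
  · rintro ⟨x, hx, hle, hlt⟩
    have h3 := phi_lt_of_dominates (c := 1) (T := tol) (tol := tol) (fun i => by simp) hle hlt
    have h4 := h₁ x hx.1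
    rw [penalized_of_feasible hx] at h4
    linarith [phi_le_penalized (P := P) hk z]
  · rintro ⟨x, hx, hle, hlt⟩
    have h3 := phi_lt_of_dominates (c := ‖x - z‖ / √(theta tol)) (tol := tol)
      (fun i => by rw [Ivl.smul, if_pos (by positivity)]) hle hlt
    have h4 := h₂ x hx.1
    have h5 : ‖x - z‖ / √(theta tol) * theta tol = √(theta tol) * ‖x - z‖ := by
      rw [div_mul_eq_mul_div, mul_div_assoc, Real.div_sqrt, mul_comm]
    rw [penalized_of_feasible hx] at h4
    linarith [phi_le_penalized (P := P) hk z]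

/-- Second-order upper bound for the square of the positive part. -/
theorem _root_.max_zero_sq_le (s t : ℝ) :
    max s 0 ^ 2 ≤ max t 0 ^ 2 + 2 * max t 0 * (s - t) + (s - t) ^ 2 := by
  rcases max_cases t 0 with ⟨h1, h2⟩ | ⟨h1, h2⟩ <;> rcases max_cases s 0 with ⟨h3, h4⟩ | ⟨h3, h4⟩ <;>
    rw [h1, h3] <;> nlinarith

end RobustProblem

/-! ### The approximate multiplier rule. -/

theorem mainTheorem1 {n m p : ℕ} (P : RobustProblem n m p)
    (hS_closed : IsClosed P.S)
    (hV_nonempty : ∀ j, (P.V j).Nonempty)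
    (hV_compact : ∀ j, IsCompact (P.V j))
    (hfL : ∀ i, LocallyLipschitz (P.fL i))
    (hfU : ∀ i, LocallyLipschitz (P.fU i))
    (hf_le : ∀ i, ∀ x ∈ P.S, P.fL i x ≤ P.fU i x)
    (hg : ∀ (j : Fin p) (x : EuclideanSpace ℝ (Fin n)),
      ∃ δ > 0, P.CondOne j x δ ∧ P.CondTwo j x δ)
    (hfeasible : P.feasible.Nonempty)
    (tol : Fin m → Ivl)
    (htol : ∀ i, 0 ≤ (tol i).lo ∧ (tol i).lo ≤ (tol i).hi)
    (htheta : 0 < RobustProblem.theta tol)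
    (hphi : BddBelow (P.phi '' P.S)) :
    ∃ (z : EuclideanSpace ℝ (Fin n)) (lam : Fin p → ℝ),
      P.IsAlmostRegularPareto tol z ∧
      (∀ j, 0 ≤ lam j) ∧
      (0 : EuclideanSpace ℝ (Fin n)) ∈
        ∑ i, (Limiting.subdiff (P.fL i) z + Limiting.subdiff (P.fU i) z) +
        ∑ j, lam j • convexHull ℝ (⋃ v ∈ P.active j z, P.subdiffG j z v) +
        Limiting.normalCone z P.S +
        √(RobustProblem.theta tol) •
          Metric.closedBall (0 : EuclideanSpace ℝ (Fin n)) 1 ∧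
      (∀ j, 0 < P.gmax j z → P.gmax j z ≤ √(RobustProblem.theta tol) → 0 < lam j) ∧
      (∀ j, P.gmax j z ≤ 0 → lam j = 0) := by
  set θ := RobustProblem.theta tol
  have hgm : ∀ j x, ∃ K : ℝ, 0 ≤ K ∧ ∃ U ∈ 𝓝 x, ∀ y ∈ U, ∀ w ∈ U,
      |P.gmax j y - P.gmax j w| ≤ K * ‖y - w‖ := fun j x => by
    obtain ⟨δ, hδ, h₁, -⟩ := hg j x
    exact h₁.exists_abs_gmax_sub_le hδ (hV_nonempty j) (hV_compact j)
  have hgcont : ∀ j, Continuous (P.gmax j) := fun j => continuous_iff_continuousAt.2 fun x => by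
    obtain ⟨K, -, U, hU, h⟩ := hgm j x
    exact Limiting.continuousAt_of_abs_sub_le hU h
  obtain ⟨x₀, hx₀⟩ := hfeasible
  obtain ⟨B, hB⟩ := hphi
  have hB' : ∀ x ∈ P.S, B ≤ P.phi x := fun x hx => hB ⟨x, hx, rfl⟩
  have hsqrt : 0 < √θ := Real.sqrt_pos.2 htheta
  -- Comparing `z` with the feasible `x₀` bounds the penalty at `z` by `φ(x₀) + θ - B`. This choice
  -- makes that bound `k * θ`, hence `max (g_j z) 0 ^ 2 ≤ θ`.
  set k : ℝ := (P.phi x₀ + θ - B) / θ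
  have hk : 0 < k := div_pos (by linarith [hB' x₀ hx₀.1]) htheta
  have hkθ : k * θ = P.phi x₀ + θ - B := div_mul_cancel₀ _ htheta.ne'
  have hcont : Continuous (P.penalized k) := by
    have hL := fun i => (hfL i).continuous
    have hU := fun i => (hfU i).continuous
    unfold RobustProblem.penalized RobustProblem.phi
    fun_prop
  obtain ⟨z, hzS, hz₁, hz₂⟩ := Limiting.exists_approx_minimizer hS_closed ⟨x₀, hx₀.1⟩
    hcont.continuousOn ⟨B, by
      rintro _ ⟨x, hx, rfl⟩
      exact (hB' x hx).trans (RobustProblem.phi_le_penalized hk.le x)⟩ htheta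
  have hzfeas : z ∈ P.epsFeasible tol := by
    refine ⟨hzS, fun j => Real.le_sqrt_of_sq_le ?_ |> (le_max_left (P.gmax j z) 0).trans⟩
    have h1 := hz₁ x₀ hx₀.1
    rw [RobustProblem.penalized_of_feasible hx₀, RobustProblem.penalized] at h1
    have h2 := Finset.single_le_sum (f := fun j => max (P.gmax j z) 0 ^ 2)
      (fun _ _ => sq_nonneg _) (Finset.mem_univ j)
    have h3 := mul_le_mul_of_nonneg_left h2 hk.le
    refine le_of_mul_le_mul_left ?_ hk
    change k * _ ≤ k * θ
    linarith [hB' z hzS]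
  -- The derivative of `s ↦ k * max s 0 ^ 2` at `g_j(z)`.
  set lam : Fin p → ℝ := fun j => 2 * k * max (P.gmax j z) 0
  have hlam : ∀ j, 0 ≤ lam j := fun j => by positivity
  refine ⟨z, lam, RobustProblem.isAlmostRegularPareto_of_penalized hk.le htheta hzfeas hz₁ hz₂,
    hlam, ?_, fun j hj _ => ?_, fun j hj => ?_⟩
  · choose K hK W hW hKW using fun j => hgm j z
    let F : (Fin m ⊕ Fin m) ⊕ (Fin p ⊕ Unit) → EuclideanSpace ℝ (Fin n) → ℝ :=
      Sum.elim (Sum.elim P.fL P.fU)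
        (Sum.elim (fun j x => lam j * P.gmax j x) fun _ x => √θ * ‖x - z‖)
    have hdist : ∀ x y : EuclideanSpace ℝ (Fin n),
        |√θ * ‖x - z‖ - √θ * ‖y - z‖| ≤ √θ * ‖x - y‖ := fun x y => by
      rw [← mul_sub, abs_mul, abs_of_pos hsqrt]
      have := abs_norm_sub_norm_le (x - z) (y - z)
      rw [sub_sub_sub_cancel_right] at this
      exact mul_le_mul_of_nonneg_left this hsqrt.le
    obtain ⟨ξ, ν, hξ, hν, hsum⟩ := Limiting.exists_isProxLimit_of_eventually (f := F) hS_closed hzS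
      -- The constant collects the second-order remainders `(g_j(x) - g_j(z))²`, each at most `K j ^
      -- 2 * ‖x - z‖ ^ 2`.
      (C := k * ∑ j, K j ^ 2) (by
        rintro ((i | i) | (j | j))
        · exact (hfL i).exists_abs_sub_le z
        · exact (hfU i).exists_abs_sub_le z
        · refine ⟨lam j * K j, mul_nonneg (hlam j) (hK j), W j, hW j, fun x hx y hy => ?_⟩
          simp only [F, Sum.elim_inr, Sum.elim_inl]
          rw [← mul_sub, abs_mul, abs_of_nonneg (hlam j), mul_assoc (lam j)]
          exact mul_le_mul_of_nonneg_left (hKW j x hx y hy) (hlam j)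
        · exact ⟨√θ, hsqrt.le, Set.univ, univ_mem, fun x _ y _ => hdist x y⟩)
      (by
        filter_upwards [iInter_mem.2 hW] with x hx hxS
        have h1 := hz₂ x hxS
        have h2 : ∑ j, max (P.gmax j x) 0 ^ 2 ≤ ∑ j, (max (P.gmax j z) 0 ^ 2 +
            2 * max (P.gmax j z) 0 * (P.gmax j x - P.gmax j z) + K j ^ 2 * ‖x - z‖ ^ 2) :=
          Finset.sum_le_sum fun j _ => by
            have h3 := hKW j x (Set.mem_iInter.1 hx j) z (mem_of_mem_nhds (hW j))
            have h4 := sq_le_sq.2 (h3.trans (le_abs_self _))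
            rw [mul_pow] at h4
            linarith [max_zero_sq_le (P.gmax j x) (P.gmax j z)]
        have h3 := mul_le_mul_of_nonneg_left h2 hk.le
        have h4 : k * ∑ j, 2 * max (P.gmax j z) 0 * (P.gmax j x - P.gmax j z) =
            ∑ j, lam j * P.gmax j x - ∑ j, lam j * P.gmax j z := by
          rw [Finset.mul_sum, ← Finset.sum_sub_distrib]
          exact Finset.sum_congr rfl fun j _ => by simp only [lam]; ring
        simp only [RobustProblem.penalized, RobustProblem.phi, Finset.sum_add_distrib, mul_add,
          ← Finset.sum_mul] at h1 h3
        simp only [F, Fintype.sum_sum_type, Sum.elim_inl, Sum.elim_inr, sub_self, norm_zero,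
          Finset.univ_unique, Finset.sum_singleton, mul_zero]
        linarith)
    have h0 : (0 : EuclideanSpace ℝ (Fin n)) = ∑ i, (ξ (.inl (.inl i)) + ξ (.inl (.inr i))) +
        ∑ j, ξ (.inr (.inl j)) + ν + ξ (.inr (.inr ())) := by
      rw [← hsum]
      simp only [Fintype.sum_sum_type, Finset.sum_add_distrib, Finset.univ_unique,
        Finset.sum_singleton]
      change _ + (_ + ξ (.inr (.inr ()))) + ν = _
      abel
    refine Set.mem_of_eq_of_mem h0 (Set.add_mem_add (Set.add_mem_add (Set.add_mem_add
      (Set.finsetSum_mem_finsetSum _ _ _ fun i _ => Set.add_mem_add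
        ((hξ (.inl (.inl i))).mem_subdiff (hfL i).continuous.continuousAt)
        ((hξ (.inl (.inr i))).mem_subdiff (hfU i).continuous.continuousAt))
      (Set.finsetSum_mem_finsetSum _ _ _ fun j _ => ?_)) hν) ?_)
    · obtain ⟨δ, hδ, h₁, h₂⟩ := hg j z
      exact RobustProblem.mem_smul_convexHull hδ h₁ h₂ (hV_nonempty j) (hV_compact j) (hlam j)
        (hξ (.inr (.inl j)))
    -- The distance term is `√θ`-Lipschitz, so its subgradient lies in the ball of radius `√θ`.
    · rw [smul_unitClosedBall_of_nonneg hsqrt.le, mem_closedBall_zero_iff]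
      exact (hξ (.inr (.inr ()))).norm_le hsqrt.le univ_mem
        fun x _ y _ => (le_abs_self _).trans (hdist x y)
  · exact mul_pos (by positivity) (lt_max_of_lt_left hj)
  · simp [lam, max_eq_right hj]
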